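/- Let $K$ be an NIP field, possibly with additional structure: an $L$-structure on a field $K$, where the language $L$ extends the language of rings, such that every formula $\varphi(x;y)$ has NIP in $K$. Let $\mathfrak C\succ K$ be a monster model, that is, $\mathfrak C$ is $\kappa$-saturated and strongly $\kappa$-homogeneous for some strong limit cardinal $\kappa>|K|+|L|$. Assume that all types over $K$ are definable. Let $G$ be an algebraic group over $K$ (a group scheme of finite type over $K$). The group $G(K)$ acts by left translation on the space $S_G(K)$ of complete types over $K$ concentrated on $G$, with its Stone topology. For a set $A\subseteq G(\mathfrak C)$ let $\dim_K(A)$ be the minimal dimension of a closed subvariety over $K$ of $G$ that contains all points of $A$. Put $\dim_K(x)=\dim_K(\{x\})$ for $x\in G(\mathfrak C)$, $\dim_K(p)=\dim_K(x)$ for $p\in S_G(K)$ and any realization $x\models p$ in $G(\mathfrak C)$, and $\dim_K(G)=\dim_K(G(\mathfrak C))$ (this is the usual dimension of $G$ if the points of $G$ are Zariski dense in $G$). Then the set $$J=\{p\in S_G(K):\dim_K(p)=\dim_K(G)\}$$ is a subflow of the $G(K)$-flow $S_G(K)$, i.e. it is nonempty, closed and $G(K)$-invariant. Moreover, there is an almost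 periodic type $p\in S_G(K)$ (a type that belongs to a minimal subflow of $S_G(K)$) with $\dim_K(p)=\dim_K(G)$. -/

import Mathlib

open CategoryTheory AlgebraicGeometry FirstOrder
open scoped MonObj Cardinal

universe u v w

/-! ### Model theory: NIP, elementary extensions, monster models, definable types -/

section ModelTheory

/-- The `L`-structure `M` has NIP: for each partitioned formula `φ(x; y)` without parameters there
is a bound on the size of the finite sets of `x`-tuples of `M` that are shattered by the instances
`φ(x; b)`. (Boundedness is an elementary property, so this is NIP of the theory of `M`.) -/
def HasNIP (L : FirstOrder.Language.{v, w}) (M : Type u) [L.Structure M] : Prop :=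
  ∀ (k m : ℕ) (φ : L.Formula (Fin k ⊕ Fin m)), ∃ N : ℕ,
    ¬ ∃ (a : Fin N → Fin k → M) (b : Set (Fin N) → Fin m → M),
      ∀ (i : Fin N) (S : Set (Fin N)), φ.Realize (Sum.elim (a i) (b S)) ↔ i ∈ S

/-- `κ`-saturation: a finitely satisfiable family of formulas in finitely many variables,
over fewer than `κ` parameters, is realized. -/
def IsSaturatedModel (L : FirstOrder.Language.{v, w}) (C : Type u) [L.Structure C] (κ : Cardinal.{u}) : Prop :=
  ∀ A : Set C, #A < κ → ∀ (n : ℕ) (F : Set (Set (Fin n → C))), (∀ s ∈ F, A.Definable L s) →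
    (∀ F₀ ⊆ F, F₀.Finite → (⋂₀ F₀).Nonempty) → (⋂₀ F).Nonempty

/-- Strong `κ`-homogeneity: an elementary map between subsets of size less than `κ`
extends to an automorphism. -/
def IsStronglyHomogeneous (L : FirstOrder.Language.{v, w}) (C : Type u) [L.Structure C]
    (κ : Cardinal.{u}) : Prop :=
  ∀ (A : Set C) (f : A → C), #A < κ →
    (∀ (n : ℕ) (φ : L.Formula (Fin n)) (a : Fin n → A),
      φ.Realize (fun i => f (a i)) ↔ φ.Realize (fun i => (a i : C))) →
    ∃ σ : C ≃[L] C, ∀ a : A, σ a = f a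

/-- `C` is a monster model over the field `K` (where `C` is a `K`-algebra): the inclusion `K → C`
is elementary, and for some strong limit cardinal `κ > |K| + |L|` the structure `C` is
`κ`-saturated and strongly `κ`-homogeneous. -/
structure IsMonsterModel (L : FirstOrder.Language.{v, w}) (K C : Type u) [Field K] [Field C] [Algebra K C]
    [L.Structure K] [L.Structure C] : Prop where
  elementary : ∃ j : K ↪ₑ[L] C, ∀ a : K, j a = algebraMap K C a
  exists_cardinal : ∃ κ : Cardinal.{u}, κ.IsStrongLimit ∧ #K < κ ∧
    Cardinal.lift.{u} L.card < Cardinal.lift.{max v w} κ ∧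
    IsSaturatedModel L C κ ∧ IsStronglyHomogeneous L C κ

/-- All types over `K` are definable: for every finite tuple `a` of the monster model `C` and every
formula `φ(x; y)`, the set of tuples `b` of `K` with `φ(x; b) ∈ tp(a/K)` is definable in `K` with
parameters. (Every complete type over `K` in finitely many variables is the type of such an `a`.) -/
def AllTypesDefinable (L : FirstOrder.Language.{v, w}) (K C : Type u) [Field K] [Field C] [Algebra K C]
    [L.Structure K] [L.Structure C] : Prop :=
  ∀ (n : ℕ) (a : Fin n → C) (m : ℕ) (φ : L.Formula (Fin n ⊕ Fin m)),
    (Set.univ : Set K).Definable L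
      {b : Fin m → K | φ.Realize (Sum.elim a (fun i => algebraMap K C (b i)))}

end ModelTheory

/-! ### Topological dynamics -/

section Dynamics

variable (Γ : Type*) {X : Type*} [Group Γ] [MulAction Γ X] [TopologicalSpace X]

/-- A subflow: a nonempty closed invariant set. -/
structure IsSubflow (Y : Set X) : Prop where
  nonempty : Y.Nonempty
  isClosed : IsClosed Y
  smul_mem : ∀ (g : Γ), ∀ x ∈ Y, g • x ∈ Y

/-- A minimal subflow: a subflow that contains no proper subflow. -/
def IsMinimalSubflow (Y : Set X) : Prop :=
  IsSubflow Γ Y ∧ ∀ Z ⊆ Y, IsSubflow Γ Z → Z = Y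

/-- A point is almost periodic if it belongs to a minimal subflow. -/
def IsAlmostPeriodic (x : X) : Prop :=
  ∃ Y : Set X, IsMinimalSubflow Γ Y ∧ x ∈ Y

end Dynamics

/-! ### Points of an algebraic group, definable sets of points, types, dimension -/

noncomputable section AlgebraicGroups

variable {K : Type u} [Field K]

/-- `Spec R` as a scheme over `Spec K`. -/
abbrev specOver (K R : Type u) [Field K] [CommRing R] [Algebra K R] : Over (Spec (.of K)) :=
  Over.mk (Spec.map (CommRingCat.ofHom (algebraMap K R)))

/-- The morphism of schemes over `K` given by a homomorphism of `K`-algebras. -/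
def specOverMap {R S : Type u} [CommRing R] [Algebra K R] [CommRing S] [Algebra K S]
    (f : R →ₐ[K] S) : specOver K S ⟶ specOver K R :=
  Over.homMk (Spec.map (CommRingCat.ofHom f.toRingHom)) (by
    simp only [Over.mk_hom, ← Spec.map_comp, ← CommRingCat.ofHom_comp]
    congr 2
    exact f.comp_algebraMap)

/-- The structure morphism of a scheme over `K`. -/
def toSpecBase (X : Over (Spec (.of K))) : X ⟶ specOver K K :=
  Over.homMk X.hom (by
    have : CommRingCat.ofHom (algebraMap K K) = 𝟙 (CommRingCat.of K) := rfl
    simp only [Over.mk_hom, this, Spec.map_id]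
    exact Category.comp_id _)

/-- `G(R)`, the set of `R`-points of `G` over `K`. It is a group if `G` is a group scheme. -/
def Points (G : Over (Spec (.of K))) (R : Type u) [CommRing R] [Algebra K R] : Type u :=
  specOver K R ⟶ G

variable {G : Over (Spec (.of K))} {R : Type u} [CommRing R] [Algebra K R] in
/-- An `R`-point of `G` as a morphism of schemes. -/
def Points.hom (x : Points G R) : specOver K R ⟶ G := x

variable {G : Over (Spec (.of K))} {R : Type u} [CommRing R] [Algebra K R] in
/-- A morphism of schemes as an `R`-point of `G`. -/
def Points.ofHom (x : specOver K R ⟶ G) : Points G R := x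

/-- The group structure on `G(R)` for a group scheme `G`. -/
instance (G : Over (Spec (.of K))) [GrpObj G] (R : Type u) [CommRing R] [Algebra K R] :
    Group (Points G R) :=
  inferInstanceAs (Group (specOver K R ⟶ G))

variable (L : FirstOrder.Language.{v, w}) (G : Over (Spec (.of K))) (C : Type u) [Field C] [Algebra K C]

/-- A set `D` of `C`-points of `G` is `K`-definable if in every affine chart, that is, for every
open immersion `i : Spec R → G` over `K` and every finite family `r` of generators of the
`K`-algebra `R` (a closed embedding of `Spec R` into affine space), the set of coordinate tuples of
the points of `D` in the chart is definable in the `L`-structure `C` with parameters from `K`. -/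
def IsDefinableOver [L.Structure C] (D : Set (Points G C)) : Prop :=
  ∀ (R : Type u) [CommRing R] [Algebra K R] (i : specOver K R ⟶ G), IsOpenImmersion i.left →
    ∀ (n : ℕ) (r : Fin n → R), Algebra.adjoin K (Set.range r) = ⊤ →
      (Set.range (algebraMap K C)).Definable L
        {c : Fin n → C | ∃ a : R →ₐ[K] C, (∀ j, c j = a (r j)) ∧ Points.ofHom (specOverMap a ≫ i) ∈ D}

/-- `S_G(K)`: the complete types over `K` concentrated on `G`, as ultrafilters of the Boolean
algebra of `K`-definable sets of points of `G` (maximal consistent sets of formulas over `K` about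
an element of `G`). -/
@[ext]
structure TypeSpace [L.Structure C] where
  sets : Set (Set (Points G C))
  definable : ∀ D ∈ sets, IsDefinableOver L G C D
  inter_mem : ∀ D ∈ sets, ∀ E ∈ sets, D ∩ E ∈ sets
  empty_notMem : ∅ ∉ sets
  mem_or_compl_mem : ∀ D, IsDefinableOver L G C D → D ∈ sets ∨ Dᶜ ∈ sets

/-- The topology on `S_G(K)` whose basic open sets are the sets `{p | D ∈ p}` for `D` definable
over `K`. -/
instance [L.Structure C] : TopologicalSpace (TypeSpace L G C) :=
  TopologicalSpace.generateFrom
    {U | ∃ D, IsDefinableOver L G C D ∧ U = {p : TypeSpace L G C | D ∈ p.sets}}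

variable {L G C} in
/-- `x ⊨ p` -/
def TypeSpace.Realizes [L.Structure C] (x : Points G C) (p : TypeSpace L G C) : Prop :=
  ∀ D ∈ p.sets, x ∈ D

variable {G C} in
/-- The Zariski dimension over `K` of a set `A` of `C`-points of `G`: the minimal dimension of a
subvariety over `K` (a closed subset of `G`) that contains all points of `A`. -/
def zariskiDim (A : Set (Points G C)) : WithBot ℕ∞ :=
  ⨅ Z : {Z : Set G.left // IsClosed Z ∧ ∀ x ∈ A, Set.range x.hom.left ⊆ Z}, topologicalKrullDim Z.1

variable {G C} in
/-- If the `C`-points are Zariski dense in `G`, then the dimension of `G(C)` is the usual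
dimension of `G`. -/
theorem zariskiDim_univ_of_dense (h : Dense (⋃ x : Points G C, Set.range x.hom.left)) :
    zariskiDim (Set.univ : Set (Points G C)) = topologicalKrullDim G.left := by
  apply le_antisymm
  · refine (iInf_le _ ⟨Set.univ, isClosed_univ, fun _ _ => Set.subset_univ _⟩).trans ?_
    exact topologicalKrullDim_subspace_le _ _
  · refine le_iInf fun Z => ?_
    have hZ : Z.1 = Set.univ := by
      rw [← Set.univ_subset_iff, ← h.closure_eq]
      exact closure_minimal (Set.iUnion_subset fun x => Z.2.2 x trivial) Z.2.1
    exact (IsHomeomorph.topologicalKrullDim_eq _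
      ((Homeomorph.setCongr hZ).trans (Homeomorph.Set.univ _)).isHomeomorph).ge

variable {L G C} in
/-- `dim_K(p)`, the dimension over `K` of a realization `x ⊨ p` in `C`. (All realizations have the
same dimension.) -/
def TypeSpace.dim [L.Structure C] (p : TypeSpace L G C) : WithBot ℕ∞ :=
  ⨆ (x : Points G C) (_ : p.Realizes x), zariskiDim {x}

variable [GrpObj G]

variable {G} in
/-- Left translation of the scheme `G` by the rational point `g`. -/
def leftTranslation (g : Points G K) : G ⟶ G := (toSpecBase G ≫ g.hom) * 𝟙 G

variable {G} in
theorem toSpecBase_unique {X : Over (Spec (.of K))} (f g : X ⟶ specOver K K) : f = g := by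
  have e : (specOver K K).hom = 𝟙 _ := by
    have : CommRingCat.ofHom (algebraMap K K) = 𝟙 (CommRingCat.of K) := rfl
    simp only [Over.mk_hom, this, Spec.map_id]
    rfl
  have key : ∀ f : X ⟶ specOver K K, f.left = X.hom := fun f => by
    have := Over.w f
    rw [e] at this
    rw [← this]
    exact (Category.comp_id f.left).symm
  exact Over.OverMorphism.ext ((key f).trans (key g).symm)

variable {G} in
theorem comp_leftTranslation {X : Over (Spec (.of K))} (x : X ⟶ G) (g : Points G K) :
    x ≫ leftTranslation g = (toSpecBase X ≫ g.hom) * x := by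
  rw [leftTranslation, MonObj.comp_mul, ← Category.assoc,
    toSpecBase_unique (x ≫ toSpecBase G) (toSpecBase X), Category.comp_id]

variable {G} in
theorem leftTranslation_one : leftTranslation (1 : Points G K) = 𝟙 G := by
  have h : (1 : Points G K).hom = (1 : specOver K K ⟶ G) := rfl
  rw [leftTranslation, h, MonObj.comp_one, one_mul]

variable {G} in
theorem leftTranslation_mul (g h : Points G K) :
    leftTranslation (g * h) = leftTranslation h ≫ leftTranslation g := by
  have e : (g * h).hom = g.hom * h.hom := rfl
  rw [comp_leftTranslation, leftTranslation, leftTranslation, e, MonObj.comp_mul, mul_assoc]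

variable {G C} in
/-- The inclusion of `G(K)` in `G(C)`. -/
def Points.baseChange (g : Points G K) : Points G C :=
  Points.ofHom (toSpecBase (specOver K C) ≫ g.hom)

variable {G C} in
theorem Points.baseChange_mul_eq (g : Points G K) (x : Points G C) :
    (g.baseChange : Points G C) * x = Points.ofHom (x.hom ≫ leftTranslation g) :=
  (comp_leftTranslation x.hom g).symm

/-- `G(K)` acts on `G(C)` by left multiplication. -/
instance : MulAction (Points G K) (Points G C) where
  smul g x := g.baseChange * x
  one_smul x := by
    change (1 : Points G K).baseChange * x = x
    rw [Points.baseChange_mul_eq, leftTranslation_one, Category.comp_id]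
    rfl
  mul_smul g h x := by
    change (g * h).baseChange * x = g.baseChange * (h.baseChange * x)
    rw [Points.baseChange_mul_eq, Points.baseChange_mul_eq, Points.baseChange_mul_eq,
      leftTranslation_mul, ← Category.assoc]
    rfl

variable {G C} in
theorem points_smul_def (g : Points G K) (x : Points G C) :
    g • x = Points.ofHom (x.hom ≫ leftTranslation g) :=
  Points.baseChange_mul_eq g x

variable {L G C} in
theorem IsDefinableOver.preimage_smul [L.Structure C] {D : Set (Points G C)}
    (hD : IsDefinableOver L G C D) (g : Points G K) :
    IsDefinableOver L G C ((fun x => g • x) ⁻¹' D) := by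
  intro R _ _ i hi n r hr
  have : IsIso (leftTranslation g) :=
    ⟨leftTranslation g⁻¹, by rw [← leftTranslation_mul, inv_mul_cancel, leftTranslation_one],
      by rw [← leftTranslation_mul, mul_inv_cancel, leftTranslation_one]⟩
  have h1 : IsIso (leftTranslation g).left :=
    inferInstanceAs (IsIso ((Over.forget _).map (leftTranslation g)))
  have : IsOpenImmersion (i ≫ leftTranslation g).left := by
    rw [Over.comp_left]
    exact MorphismProperty.comp_mem _ _ _ hi (inferInstanceAs (IsOpenImmersion _))
  have h := hD R (i ≫ leftTranslation g) this n r hr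
  have e : ∀ a : R →ₐ[K] C, g • Points.ofHom (specOverMap a ≫ i) =
      Points.ofHom (specOverMap a ≫ i ≫ leftTranslation g) := fun a =>
    (points_smul_def g _).trans (congrArg Points.ofHom (Category.assoc _ _ _))
  simpa only [Set.mem_preimage, e] using h

variable {L G C} in
theorem isDefinableOver_of_preimage_smul [L.Structure C] {D : Set (Points G C)} (g : Points G K)
    (hD : IsDefinableOver L G C ((fun x => g • x) ⁻¹' D)) : IsDefinableOver L G C D := by
  have h := hD.preimage_smul g⁻¹
  have e : (fun x => g⁻¹ • x) ⁻¹' ((fun x => g • x) ⁻¹' D) = D := by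
    ext x
    simp only [Set.mem_preimage, smul_inv_smul]
  rwa [e] at h

variable {L G C} in
/-- Left translation of types: `g • tp(x/K) = tp(g • x/K)`, so that a `K`-definable set `D` belongs
to `g • p` if and only if `{x | g • x ∈ D}` belongs to `p`. -/
def TypeSpace.translate [L.Structure C] (g : Points G K) (p : TypeSpace L G C) :
    TypeSpace L G C where
  sets := {D | (fun x => g • x) ⁻¹' D ∈ p.sets}
  definable _ hD := isDefinableOver_of_preimage_smul g (p.definable _ hD)
  inter_mem _ hD _ hE := p.inter_mem _ hD _ hE
  empty_notMem h := p.empty_notMem h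
  mem_or_compl_mem _ hD := p.mem_or_compl_mem _ (hD.preimage_smul g)

variable {L G C} in
theorem TypeSpace.mem_translate [L.Structure C] (g : Points G K) (p : TypeSpace L G C)
    (D : Set (Points G C)) : D ∈ (p.translate g).sets ↔ (fun x => g • x) ⁻¹' D ∈ p.sets :=
  Iff.rfl

variable {L G C} in
theorem TypeSpace.translate_one [L.Structure C] (p : TypeSpace L G C) :
    p.translate (1 : Points G K) = p := by
  have e : (fun x : Points G C => (1 : Points G K) • x) = id := funext fun x => one_smul _ x
  refine TypeSpace.ext (Set.ext fun D => ?_)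
  rw [TypeSpace.mem_translate, e, Set.preimage_id]

variable {L G C} in
theorem TypeSpace.translate_mul [L.Structure C] (g h : Points G K) (p : TypeSpace L G C) :
    p.translate (g * h) = (p.translate h).translate g := by
  have e : (fun x : Points G C => (g * h) • x) = (fun x => g • x) ∘ (fun x => h • x) :=
    funext fun x => mul_smul g h x
  refine TypeSpace.ext (Set.ext fun D => ?_)
  rw [TypeSpace.mem_translate, TypeSpace.mem_translate, TypeSpace.mem_translate, e,
    Set.preimage_comp]

/-- The action of `G(K)` on `S_G(K)` by left translation. -/
instance [L.Structure C] : MulAction (Points G K) (TypeSpace L G C) where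
  smul g p := p.translate g
  one_smul p := p.translate_one
  mul_smul g h p := p.translate_mul g h

end AlgebraicGroups

/-! ### Krull dimension of finite unions of closed sets -/

section Topology

open TopologicalSpace

/-! Let `d` be the dimension of `G(C)`. By saturation and quasi-compactness, every type `p` is
realized (`TypeSpace.exists_realizes`). A realization lies in a closed `Z` exactly when the
definable set `Z(C)` belongs to `p`. So `p` has dimension `d` if and only if `p` contains no `Z(C)`
with `Z` closed of dimension less than `d` (`TypeSpace.dim_eq_zariskiDim_univ_iff`).

This criterion gives the three properties of a subflow. `J` is closed, as an intersection of clopen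
sets. It is invariant, because left translation by a rational point is an automorphism of the scheme
`G` and preserves dimensions of closed sets. It is nonempty, because a finite union of closed sets
of dimension less than `d` again has dimension less than `d` and so cannot contain `G(C)`; hence the
complements of the sets `Z(C)` have the finite intersection property and extend to a type
(`TypeSpace.exists_forall_zariskiDim_univ_le`).

Finally `S_G(K)` is compact, so by Zorn's lemma `J` contains a minimal subflow, whose points are
almost periodic. -/

theorem IsIrreducible.preimage_subtypeVal {X : Type*} [TopologicalSpace X] {A s : Set X}
    (hA : IsClosed A) (hs : IsIrreducible s) (hsA : s ⊆ A) :
    IsIrreducible ((↑) ⁻¹' s : Set A) := by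
  obtain ⟨x, hx⟩ := hs.nonempty
  refine ⟨⟨⟨x, hsA hx⟩, hx⟩, ?_⟩
  rw [isPreirreducible_iff_isClosed_union_isClosed]
  intro z₁ z₂ h₁ h₂ hz
  -- Since `A` is closed, closed subsets of `A` are closed in `X`, where irreducibility of `s`
  -- applies.
  have key := isPreirreducible_iff_isClosed_union_isClosed.1 hs.isPreirreducible
    ((↑) '' z₁) ((↑) '' z₂) (hA.isClosedMap_subtype_val _ h₁) (hA.isClosedMap_subtype_val _ h₂)
    (by
      intro y hy
      rw [← Set.image_union]
      exact ⟨⟨y, hsA hy⟩, hz hy, rfl⟩)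
  refine key.imp (fun h y hy => ?_) (fun h y hy => ?_)
  · obtain ⟨y', hy', e⟩ := h hy
    rwa [← Subtype.ext e]
  · obtain ⟨y', hy', e⟩ := h hy
    rwa [← Subtype.ext e]

theorem length_le_topologicalKrullDim_of_subset {X : Type*} [TopologicalSpace X] {A : Set X}
    (hA : IsClosed A) (p : LTSeries (IrreducibleCloseds X)) (hp : (p.last : Set X) ⊆ A) :
    (p.length : WithBot ℕ∞) ≤ topologicalKrullDim A := by
  have hi : ∀ i, (p i : Set X) ⊆ A := fun i => (SetLike.coe_subset_coe.2 (p.monotone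
    (Fin.le_last i))).trans hp
  let q : LTSeries (IrreducibleCloseds A) :=
    LTSeries.mk p.length
      (fun i => ⟨(↑) ⁻¹' (p i : Set X), (p i).isIrreducible.preimage_subtypeVal hA (hi i),
        (p i).isClosed.preimage continuous_subtype_val⟩) (by
      intro i k hik
      have h := p.strictMono hik
      refine lt_of_le_not_ge (fun x hx => h.le hx) fun hle => h.not_ge fun x hx => ?_
      exact @hle ⟨x, hi k hx⟩ hx)
  exact le_iSup (fun q : LTSeries (IrreducibleCloseds A) => (q.length : WithBot ℕ∞)) q

/-- The top member of a chain is irreducible, so it lies in `A` or in `B`, and the whole chain lies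
there with it. -/
theorem topologicalKrullDim_le_max_of_union_eq_univ {X : Type*} [TopologicalSpace X] {A B : Set X}
    (hA : IsClosed A) (hB : IsClosed B) (h : A ∪ B = Set.univ) :
    topologicalKrullDim X ≤ max (topologicalKrullDim A) (topologicalKrullDim B) := by
  refine iSup_le fun p => ?_
  rcases isPreirreducible_iff_isClosed_union_isClosed.1 p.last.isIrreducible.isPreirreducible A B
    hA hB (h ▸ Set.subset_univ _) with h | h
  · exact (length_le_topologicalKrullDim_of_subset hA p h).trans (le_max_left _ _)
  · exact (length_le_topologicalKrullDim_of_subset hB p h).trans (le_max_right _ _)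

theorem topologicalKrullDim_union_le {X : Type*} [TopologicalSpace X] {A B : Set X}
    (hA : IsClosed A) (hB : IsClosed B) :
    topologicalKrullDim (A ∪ B : Set X) ≤
      max (topologicalKrullDim A) (topologicalKrullDim B) := by
  have key : ∀ D : Set X, topologicalKrullDim ((↑) ⁻¹' D : Set (A ∪ B : Set X)) ≤
      topologicalKrullDim D := fun D => by
    let f : ((↑) ⁻¹' D : Set (A ∪ B : Set X)) → D := fun x => ⟨x.1.1, x.2⟩
    have hf : Topology.IsInducing f := by
      apply Topology.IsInducing.of_comp (g := ((↑) : D → X))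
      · exact (continuous_subtype_val.comp continuous_subtype_val).subtype_mk _
      · exact continuous_subtype_val
      · change Topology.IsInducing (((↑) : (A ∪ B : Set X) → X) ∘ Subtype.val)
        exact Topology.IsInducing.subtypeVal.comp Topology.IsInducing.subtypeVal
    exact hf.topologicalKrullDim_le
  refine (topologicalKrullDim_le_max_of_union_eq_univ (hA.preimage continuous_subtype_val)
    (hB.preimage continuous_subtype_val) ?_).trans (max_le_max (key A) (key B))
  exact Set.eq_univ_of_forall fun x => x.2

/-- The hypothesis `⊥ < d` serves the empty union, whose dimension is `⊥`. -/
theorem topologicalKrullDim_sUnion_lt {X : Type*} [TopologicalSpace X] {S : Set (Set X)}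
    (hS : S.Finite) (hcl : ∀ A ∈ S, IsClosed A) {d : WithBot ℕ∞} (hd : ⊥ < d)
    (hlt : ∀ A ∈ S, topologicalKrullDim A < d) : topologicalKrullDim (⋃₀ S : Set X) < d := by
  induction S, hS using Set.Finite.induction_on with
  | empty =>
    have : IsEmpty (IrreducibleCloseds (⋃₀ (∅ : Set (Set X)) : Set X)) :=
      ⟨fun s => by
        obtain ⟨x, -⟩ := s.isIrreducible.nonempty
        simpa using x.2⟩
    rwa [topologicalKrullDim, Order.krullDim_eq_bot]
  | @insert A S _ hS ih =>
    rw [Set.sUnion_insert]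
    have hS' : IsClosed (⋃₀ S) :=
      Set.sUnion_eq_biUnion (s := S) ▸ hS.isClosed_biUnion fun B hB =>
        hcl B (Set.mem_insert_of_mem _ hB)
    refine (topologicalKrullDim_union_le (hcl A (Set.mem_insert _ _)) hS').trans_lt (max_lt ?_ ?_)
    · exact hlt A (Set.mem_insert _ _)
    · exact ih (fun B hB => hcl B (Set.mem_insert_of_mem _ hB))
        (fun B hB => hlt B (Set.mem_insert_of_mem _ hB))

end Topology

/-! ### Minimal subflows of compact flows -/

section Dynamics

variable {Γ X : Type*} [Group Γ] [MulAction Γ X] [TopologicalSpace X]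

/-- Zorn's lemma for reverse inclusion: by compactness, the intersection of a nonempty chain of
subflows is nonempty. -/
theorem IsSubflow.exists_isMinimalSubflow_subset [CompactSpace X] {Y : Set X}
    (hY : IsSubflow Γ Y) : ∃ Z ⊆ Y, IsMinimalSubflow Γ Z := by
  obtain ⟨Z, hZY, hZ⟩ := zorn_superset_nonempty {Z : Set X | IsSubflow Γ Z}
    (fun c hc hchain hne => by
      have : Nonempty c := hne.to_subtype
      refine ⟨⋂₀ c, ⟨?_, ?_, ?_⟩, fun s hs => Set.sInter_subset_of_mem hs⟩
      · exact IsCompact.nonempty_sInter_of_directed_nonempty_isCompact_isClosed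
          (fun U hU V hV => (hchain.total hU hV).elim
            (fun h => ⟨U, hU, subset_rfl, h⟩) fun h => ⟨V, hV, h, subset_rfl⟩)
          (fun U hU => (hc hU).nonempty)
          (fun U hU => (hc hU).isClosed.isCompact) (fun U hU => (hc hU).isClosed)
      · exact isClosed_sInter fun U hU => (hc hU).isClosed
      · exact fun g x hx U hU => (hc hU).smul_mem g x (hx U hU)) Y hY
  exact ⟨Z, hZY, hZ.prop, fun W hWZ hW => hWZ.antisymm (hZ.le_of_le hW hWZ)⟩

theorem IsSubflow.exists_isAlmostPeriodic_mem [CompactSpace X] {Y : Set X}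
    (hY : IsSubflow Γ Y) : ∃ x ∈ Y, IsAlmostPeriodic Γ x := by
  obtain ⟨Z, hZY, hZ⟩ := hY.exists_isMinimalSubflow_subset
  obtain ⟨x, hx⟩ := hZ.1.nonempty
  exact ⟨x, hZY hx, Z, hZ, hx⟩

end Dynamics

/-! ### Definability of zero loci, and coordinates of algebra homomorphisms -/

section ZeroLocus

open MvPolynomial

/-- By Hilbert's basis theorem finitely many equations suffice, and their coefficients come from
`K`. -/
theorem definable_setOf_forall_aeval_eq_zero {K C : Type*} [Field K] [Field C] [Algebra K C]
    {L : FirstOrder.Language.{v, w}} [L.Structure C] (j : FirstOrder.Language.ring →ᴸ L)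
    [FirstOrder.Ring.CompatibleRing C] [j.IsExpansionOn C] {n : ℕ}
    (I : Ideal (MvPolynomial (Fin n) K)) :
    (Set.range (algebraMap K C)).Definable L
      {c : Fin n → C | ∀ p ∈ I, aeval c p = 0} := by
  classical
  obtain ⟨S, rfl⟩ := (isNoetherianRing_iff_ideal_fg _).1 inferInstance I
  have h := (FirstOrder.Ring.mvPolynomial_zeroLocus_definable
    (S.image (map (algebraMap K C)))).map_expansion j
  have e : {c : Fin n → C | ∀ p ∈ Ideal.span (S : Set (MvPolynomial (Fin n) K)), aeval c p = 0} =
      zeroLocus C (Ideal.span (S.image (map (algebraMap K C)) : Set (MvPolynomial (Fin n) C))) := by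
    ext c
    rw [zeroLocus_span]
    have : (∀ p ∈ Ideal.span (S : Set (MvPolynomial (Fin n) K)), aeval c p = 0) ↔
        Ideal.span (S : Set (MvPolynomial (Fin n) K)) ≤ RingHom.ker (aeval c).toRingHom :=
      Iff.rfl
    rw [Set.mem_ofPred_eq, this, Ideal.span_le]
    simp [Set.subset_def, aeval_def]
  rw [e]
  refine h.mono ?_
  simp only [Set.iUnion_subset_iff, Finset.mem_image]
  rintro _ ⟨p, -, rfl⟩ _ ⟨m, -, rfl⟩
  exact ⟨p.coeff m, (coeff_map _ _ _).symm⟩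

theorem Algebra.algHom_ext_of_adjoin_range_eq_top {K R C J : Type*} [CommRing K] [CommRing R]
    [Algebra K R] [CommRing C] [Algebra K C] {r : J → R}
    (hr : Algebra.adjoin K (Set.range r) = ⊤) {a b : R →ₐ[K] C} (h : ∀ i, a (r i) = b (r i)) :
    a = b :=
  AlgHom.ext_of_adjoin_eq_top hr fun x hx => by
    obtain ⟨i, rfl⟩ := hx
    exact h i

/-- The pulled-back ideal contains all relations between the generators `r`. A tuple satisfying
these relations is the image of `r` under a homomorphism on `R`, and the other elements of the ideal
express vanishing on `I`. -/
theorem exists_algHom_vanishing_iff {K R C : Type*} [Field K] [CommRing R] [Algebra K R] [Field C]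
    [Algebra K C] {n : ℕ} {r : Fin n → R} (hr : Algebra.adjoin K (Set.range r) = ⊤)
    (I : Ideal R) (c : Fin n → C) :
    (∃ a : R →ₐ[K] C, (∀ i, c i = a (r i)) ∧ ∀ f ∈ I, a f = 0) ↔
      ∀ p ∈ I.comap (aeval r : MvPolynomial (Fin n) K →ₐ[K] R), aeval c p = 0 := by
  have hsurj : Function.Surjective (aeval r : MvPolynomial (Fin n) K →ₐ[K] R) := by
    rw [← AlgHom.range_eq_top, ← Algebra.adjoin_range_eq_range_aeval, hr]
  constructor
  · rintro ⟨a, ha, hI⟩ p hp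
    have : aeval c = a.comp (aeval r : MvPolynomial (Fin n) K →ₐ[K] R) := by
      ext i
      simp [ha]
    rw [this]
    exact hI _ hp
  · intro h
    have hk : ∀ p, (aeval r : MvPolynomial (Fin n) K →ₐ[K] R) p = 0 → aeval c p = 0 :=
      fun p hp => h p (by simp [Ideal.mem_comap, hp])
    let e := Ideal.quotientKerAlgEquivOfSurjective hsurj
    let a : R →ₐ[K] C := (Ideal.Quotient.liftₐ _ (aeval c) hk).comp e.symm.toAlgHom
    have ha : ∀ p, a (aeval r p) = aeval c p := fun p => by
      have : e.symm (aeval r p) = Ideal.Quotient.mk _ p := by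
        rw [AlgEquiv.symm_apply_eq]
        rfl
      change Ideal.Quotient.liftₐ _ (aeval c) hk (e.symm (aeval r p)) = _
      rw [this]
      rfl
    refine ⟨a, fun i => ?_, fun f hf => ?_⟩
    · simpa using (ha (X i)).symm
    · obtain ⟨p, rfl⟩ := hsurj f
      rw [ha]
      exact h p hf

end ZeroLocus

/-! ### Points on Zariski closed sets -/

section Points

variable {K : Type u} [Field K] {G : Over (Spec (.of K))} {C : Type u} [Field C] [Algebra K C]

/-- The `C`-points of `G` that lie on the subset `Z` of `G`. -/
def pointsOn (C : Type u) [Field C] [Algebra K C] (Z : Set G.left) : Set (Points G C) :=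
  {x | Set.range x.hom.left ⊆ Z}

/-- `Spec C` is a single point. Hence `pointsOn` commutes with complements and unions. -/
theorem Points.exists_range_eq_singleton (x : Points G C) :
    ∃ z : G.left, Set.range x.hom.left = {z} := by
  have : Unique (specOver K C).left := inferInstanceAs (Unique (PrimeSpectrum C))
  exact ⟨_, Set.range_unique⟩

theorem pointsOn_compl (Z : Set G.left) : pointsOn C Zᶜ = (pointsOn C Z)ᶜ := by
  ext x
  obtain ⟨z, hz⟩ := x.exists_range_eq_singleton
  simp [pointsOn, hz]

theorem pointsOn_univ : pointsOn C (Set.univ : Set G.left) = Set.univ :=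
  Set.eq_univ_of_forall fun _ => Set.subset_univ _

theorem mem_pointsOn_sUnion {S : Set (Set G.left)} {x : Points G C} :
    x ∈ pointsOn C (⋃₀ S) ↔ ∃ Z ∈ S, x ∈ pointsOn C Z := by
  obtain ⟨z, hz⟩ := x.exists_range_eq_singleton
  simp [pointsOn, hz]

/-- The only prime of `C` is zero, so its pullback is the kernel of `a`; and `W` is the zero locus
of its vanishing ideal. -/
theorem comap_mem_iff_vanishing {R : Type u} [CommRing R] [Algebra K R]
    {W : Set (PrimeSpectrum R)} (hW : IsClosed W) (a : R →ₐ[K] C) (y : PrimeSpectrum C) :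
    PrimeSpectrum.comap a.toRingHom y ∈ W ↔ ∀ f ∈ PrimeSpectrum.vanishingIdeal W, a f = 0 := by
  nth_rw 1 [← hW.closure_eq]
  rw [← PrimeSpectrum.zeroLocus_vanishingIdeal_eq_closure, PrimeSpectrum.mem_zeroLocus]
  refine forall₂_congr fun f _ => ?_
  change a f ∈ y.asIdeal ↔ _
  rw [y.asIdeal.eq_bot_of_prime]
  exact Iff.rfl

theorem mem_pointsOn_iff_vanishing {R : Type u} [CommRing R] [Algebra K R] (i : specOver K R ⟶ G)
    {Z : Set G.left} (hZ : IsClosed Z) (a : R →ₐ[K] C) :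
    Points.ofHom (specOverMap a ≫ i) ∈ pointsOn C Z ↔
      ∀ f ∈ PrimeSpectrum.vanishingIdeal (i.left ⁻¹' Z : Set (PrimeSpectrum R)), a f = 0 := by
  refine Iff.trans ?_ (comap_mem_iff_vanishing (hZ.preimage i.left.continuous) a default)
  change Set.range (specOverMap a ≫ i).left ⊆ Z ↔ _
  rw [Set.range_subset_iff]
  exact Unique.forall_iff (α := PrimeSpectrum C) (p := fun y =>
    PrimeSpectrum.comap a.toRingHom y ∈ (i.left ⁻¹' Z : Set (PrimeSpectrum R)))

variable (L : FirstOrder.Language.{v, w}) [L.Structure C]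

theorem isDefinableOver_pointsOn (j : FirstOrder.Language.ring →ᴸ L)
    [FirstOrder.Ring.CompatibleRing C] [j.IsExpansionOn C] {Z : Set G.left} (hZ : IsClosed Z) :
    IsDefinableOver L G C (pointsOn C Z) := by
  intro R _ _ i _ n r hr
  simp only [mem_pointsOn_iff_vanishing i hZ, exists_algHom_vanishing_iff hr]
  exact definable_setOf_forall_aeval_eq_zero j _

variable {L} in
theorem isDefinableOver_univ (j : FirstOrder.Language.ring →ᴸ L)
    [FirstOrder.Ring.CompatibleRing C] [j.IsExpansionOn C] : IsDefinableOver L G C Set.univ :=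
  pointsOn_univ (G := G) (C := C) ▸ isDefinableOver_pointsOn L j isClosed_univ

end Points

/-! ### Definable sets of points and the compactness of the type space -/

section Definable

variable {K : Type u} [Field K] {G : Over (Spec (.of K))} {C : Type u} [Field C] [Algebra K C]
  {L : FirstOrder.Language.{v, w}} [L.Structure C]

theorem IsDefinableOver.inter {D E : Set (Points G C)} (hD : IsDefinableOver L G C D)
    (hE : IsDefinableOver L G C E) : IsDefinableOver L G C (D ∩ E) := by
  intro R _ _ i hi n r hr
  convert (hD R i hi n r hr).inter (hE R i hi n r hr) using 1
  ext c
  constructor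
  · rintro ⟨a, ha, h⟩
    exact ⟨⟨a, ha, h.1⟩, a, ha, h.2⟩
  · rintro ⟨⟨a, ha, h⟩, b, hb, h'⟩
    -- Both memberships concern the same point, since a point of the chart is determined by its
    -- coordinates.
    obtain rfl := Algebra.algHom_ext_of_adjoin_range_eq_top hr fun k => (ha k).symm.trans (hb k)
    exact ⟨a, ha, h, h'⟩

theorem IsDefinableOver.compl {D : Set (Points G C)} (hD : IsDefinableOver L G C D)
    (hu : IsDefinableOver L G C Set.univ) : IsDefinableOver L G C Dᶜ := by
  intro R _ _ i hi n r hr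
  convert (hu R i hi n r hr).sdiff (hD R i hi n r hr) using 1
  ext c
  constructor
  · rintro ⟨a, ha, h⟩
    refine ⟨⟨a, ha, trivial⟩, ?_⟩
    rintro ⟨b, hb, h'⟩
    obtain rfl := Algebra.algHom_ext_of_adjoin_range_eq_top hr fun k => (ha k).symm.trans (hb k)
    exact h h'
  · rintro ⟨⟨a, ha, -⟩, h⟩
    exact ⟨a, ha, fun h' => h ⟨a, ha, h'⟩⟩

namespace TypeSpace

variable {p : TypeSpace L G C}

theorem univ_mem (hu : IsDefinableOver L G C Set.univ) : Set.univ ∈ p.sets :=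
  (p.mem_or_compl_mem _ hu).resolve_right fun h => p.empty_notMem (by rwa [← Set.compl_univ])

theorem compl_mem_iff {D : Set (Points G C)} (hD : IsDefinableOver L G C D) :
    Dᶜ ∈ p.sets ↔ D ∉ p.sets := by
  refine ⟨fun h h' => p.empty_notMem ?_, (p.mem_or_compl_mem D hD).resolve_left⟩
  rw [← Set.inter_compl_self D]
  exact p.inter_mem _ h' _ h

theorem sInter_mem (hu : IsDefinableOver L G C Set.univ) {S : Set (Set (Points G C))}
    (hS : S.Finite) (h : S ⊆ p.sets) : ⋂₀ S ∈ p.sets := by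
  induction S, hS using Set.Finite.induction_on with
  | empty => simpa using p.univ_mem hu
  | insert _ _ ih =>
    rw [Set.sInter_insert]
    exact p.inter_mem _ (h (Set.mem_insert _ _)) _ (ih ((Set.subset_insert _ _).trans h))

theorem nonempty_of_mem {D : Set (Points G C)} (h : D ∈ p.sets) : D.Nonempty := by
  by_contra hD
  rw [Set.not_nonempty_iff_eq_empty] at hD
  exact p.empty_notMem (hD ▸ h)

/-- The complete type of the definable sets that belong to an ultrafilter on `G(C)`. -/
def ofUltrafilter (hu : IsDefinableOver L G C Set.univ) (F : Ultrafilter (Points G C)) :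
    TypeSpace L G C where
  sets := {D | IsDefinableOver L G C D ∧ D ∈ F}
  definable _ h := h.1
  inter_mem _ hD _ hE := ⟨hD.1.inter hE.1, Filter.inter_mem hD.2 hE.2⟩
  empty_notMem h := F.empty_notMem h.2
  mem_or_compl_mem D hD := (F.mem_or_compl_mem D).imp (fun h => ⟨hD, h⟩) fun h => ⟨hD.compl hu, h⟩

theorem isOpen_setOf_mem {D : Set (Points G C)} (hD : IsDefinableOver L G C D) :
    IsOpen {p : TypeSpace L G C | D ∈ p.sets} :=
  TopologicalSpace.isOpen_generateFrom_of_mem ⟨D, hD, rfl⟩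

theorem isClosed_setOf_notMem {D : Set (Points G C)} (hD : IsDefinableOver L G C D) :
    IsClosed {p : TypeSpace L G C | D ∉ p.sets} :=
  ⟨by simpa [Set.compl_def] using isOpen_setOf_mem hD⟩

/-- An ultrafilter `F` on types converges to the type of those `D` that belong to `F`-almost every
type. -/
theorem compactSpace (hu : IsDefinableOver L G C Set.univ) : CompactSpace (TypeSpace L G C) := by
  refine ⟨isCompact_iff_ultrafilter_le_nhds'.2 fun F _ => ?_⟩
  let p : TypeSpace L G C :=
    { sets := {D | IsDefinableOver L G C D ∧ {q : TypeSpace L G C | D ∈ q.sets} ∈ F}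
      definable := fun _ h => h.1
      inter_mem := fun D hD E hE => ⟨hD.1.inter hE.1, by
        filter_upwards [hD.2, hE.2] with q hq hq'
        exact q.inter_mem D hq E hq'⟩
      empty_notMem := fun h => by
        obtain ⟨q, hq⟩ := F.nonempty_of_mem h.2
        exact q.empty_notMem hq
      mem_or_compl_mem := fun D hD => by
        refine (F.mem_or_compl_mem {q : TypeSpace L G C | D ∈ q.sets}).imp (fun h => ⟨hD, h⟩)
          fun h => ⟨hD.compl hu, ?_⟩
        filter_upwards [h] with q hq
        exact (compl_mem_iff hD).2 hq }
  refine ⟨p, trivial, ?_⟩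
  rw [TopologicalSpace.nhds_generateFrom]
  refine le_iInf₂ fun U hU => ?_
  obtain ⟨hp, D, hD, rfl⟩ := hU
  exact Filter.le_principal_iff.2 hp.2

end TypeSpace

end Definable

/-! ### Realization of types in the monster model -/

section Realization

variable {K : Type u} [Field K] {G : Over (Spec (.of K))} {C : Type u} [Field C] [Algebra K C]

theorem exists_chart [LocallyOfFiniteType G.hom] (k : G.left.affineOpenCover.I₀) :
    ∃ (R : Type u) (_ : CommRing R) (_ : Algebra K R) (i : specOver K R ⟶ G) (n : ℕ)
      (r : Fin n → R), IsOpenImmersion i.left ∧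
      Set.range i.left = Set.range (G.left.affineOpenCover.f k) ∧
      Algebra.adjoin K (Set.range r) = ⊤ := by
  let f := G.left.affineOpenCover.f k
  let φ := Spec.preimage (f ≫ G.hom)
  have hφ : Spec.map φ = f ≫ G.hom := Spec.map_preimage _
  have hft : φ.hom.FiniteType := by
    have : LocallyOfFiniteType (Spec.map φ) := hφ ▸ inferInstance
    exact HasRingHomProperty.Spec_iff.1 this
  let : Algebra K (G.left.affineOpenCover.X k) := φ.hom.toAlgebra
  obtain ⟨s, hs⟩ := (show Algebra.FiniteType K (G.left.affineOpenCover.X k) from hft).out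
  refine ⟨G.left.affineOpenCover.X k, inferInstance, φ.hom.toAlgebra, Over.homMk f hφ.symm, s.card,
    fun m => s.equivFin.symm m, inferInstanceAs (IsOpenImmersion f), rfl, ?_⟩
  rw [← hs]
  congr 1
  exact (s.equivFin.symm.surjective.range_comp _).trans Subtype.range_coe

theorem exists_specOverMap_comp_eq {R : Type u} [CommRing R] [Algebra K R] (i : specOver K R ⟶ G)
    [IsOpenImmersion i.left] (x : Points G C) (hx : x ∈ pointsOn C (Set.range i.left)) :
    ∃ a : R →ₐ[K] C, Points.ofHom (specOverMap a ≫ i) = x := by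
  have hx' : Set.range x.hom.left ⊆ Set.range i.left := hx
  let l : Spec (.of C) ⟶ Spec (.of R) := IsOpenImmersion.lift i.left x.hom.left hx'
  have hl : l ≫ i.left = x.hom.left := IsOpenImmersion.lift_fac _ _ _
  let ψ : CommRingCat.of R ⟶ CommRingCat.of C := Spec.preimage l
  have hψ : Spec.map ψ = l := Spec.map_preimage l
  have hw : CommRingCat.ofHom (algebraMap K R) ≫ ψ = CommRingCat.ofHom (algebraMap K C) := by
    apply Spec.map_injective
    rw [Spec.map_comp, hψ]
    have h1 : i.left ≫ G.hom = Spec.map (CommRingCat.ofHom (algebraMap K R)) := Over.w i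
    have h2 : x.hom.left ≫ G.hom = Spec.map (CommRingCat.ofHom (algebraMap K C)) := Over.w x.hom
    rw [← h1, ← h2, ← hl, Category.assoc]
  let a : R →ₐ[K] C :=
    { ψ.hom with
      commutes' := fun c => congrArg (fun f : CommRingCat.of K ⟶ CommRingCat.of C => f.hom c) hw }
  refine ⟨a, Over.OverMorphism.ext ?_⟩
  change Spec.map ψ ≫ i.left = x.hom.left
  rw [hψ, hl]

variable {L : FirstOrder.Language.{v, w}} [L.Structure C]

/-- In chart coordinates the members of `p` form a finitely satisfiable family over the image of
`K`, which has fewer than `κ` elements. Saturation gives a common coordinate tuple, and this tuple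
determines one point of the chart. -/
theorem TypeSpace.exists_realizes_of_chart {κ : Cardinal.{u}} (hκ : IsSaturatedModel L C κ)
    (hK : #K < κ) (hu : IsDefinableOver L G C Set.univ) {R : Type u} [CommRing R] [Algebra K R]
    (i : specOver K R ⟶ G) [IsOpenImmersion i.left] {n : ℕ} {r : Fin n → R}
    (hr : Algebra.adjoin K (Set.range r) = ⊤) {p : TypeSpace L G C}
    (hp : pointsOn C (Set.range i.left) ∈ p.sets) : ∃ x, p.Realizes x := by
  let F : Set (Points G C) → Set (Fin n → C) := fun D =>
    {c | ∃ a : R →ₐ[K] C, (∀ k, c k = a (r k)) ∧ Points.ofHom (specOverMap a ≫ i) ∈ D}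
  obtain ⟨c, hc⟩ := hκ (Set.range (algebraMap K C)) (Cardinal.mk_range_le.trans_lt hK) n
    (F '' p.sets) (by
      rintro _ ⟨D, hD, rfl⟩
      exact p.definable D hD R i inferInstance n r hr) (by
      intro S hS hfin
      classical
      lift S to Finset (Set (Fin n → C)) using hfin
      obtain ⟨T, hT, rfl⟩ := Finset.subset_set_image_iff.1 hS
      obtain ⟨x, hx, hxT⟩ := nonempty_of_mem
        (p.inter_mem _ hp _ (p.sInter_mem hu T.finite_toSet hT))
      obtain ⟨a, rfl⟩ := exists_specOverMap_comp_eq i x hx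
      refine ⟨fun k => a (r k), ?_⟩
      rw [Finset.coe_image]
      rintro _ ⟨D, hD, rfl⟩
      exact ⟨a, fun _ => rfl, hxT D hD⟩)
  obtain ⟨a, ha, -⟩ := hc _ ⟨_, hp, rfl⟩
  refine ⟨Points.ofHom (specOverMap a ≫ i), fun D hD => ?_⟩
  obtain ⟨b, hb, h⟩ := hc _ ⟨D, hD, rfl⟩
  obtain rfl := Algebra.algHom_ext_of_adjoin_range_eq_top hr fun k => (ha k).symm.trans (hb k)
  exact h

/-- Finitely many affine charts cover `G`. One of them must belong to `p`, since otherwise `p` would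
contain the intersection of their complements, which is empty. -/
theorem TypeSpace.exists_realizes (j : FirstOrder.Language.ring →ᴸ L)
    [FirstOrder.Ring.CompatibleRing C] [j.IsExpansionOn C] [LocallyOfFiniteType G.hom]
    [QuasiCompact G.hom] {κ : Cardinal.{u}} (hκ : IsSaturatedModel L C κ) (hK : #K < κ)
    (p : TypeSpace L G C) : ∃ x, p.Realizes x := by
  have hu : IsDefinableOver L G C Set.univ :=
    isDefinableOver_univ j
  have hcomp : CompactSpace G.left := QuasiCompact.compactSpace_of_compactSpace G.hom
  let U : G.left.affineOpenCover.I₀ → Set G.left := fun k => Set.range (G.left.affineOpenCover.f k)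
  have hU : ∀ k, IsOpen (U k) := fun k => (G.left.affineOpenCover.f k).isOpenEmbedding.isOpen_range
  obtain ⟨t, ht⟩ := isCompact_univ.elim_finite_subcover U hU
    fun z _ => Set.mem_iUnion.2 ⟨_, G.left.affineOpenCover.covers z⟩
  by_cases h : ∃ k, pointsOn C (U k) ∈ p.sets
  · obtain ⟨k, hk⟩ := h
    obtain ⟨R, _, _, i, n, r, hi, hrange, hr⟩ := exists_chart (K := K) k
    exact exists_realizes_of_chart hκ hK hu i hr (hrange ▸ hk)
  · exfalso
    have hdef : ∀ k, IsDefinableOver L G C (pointsOn C (U k)) := fun k => by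
      have := (isDefinableOver_pointsOn (C := C) L j (hU k).isClosed_compl).compl hu
      rwa [← pointsOn_compl, compl_compl] at this
    have hmem := p.sInter_mem hu (S := (fun k => (pointsOn C (U k))ᶜ) '' t)
      (t.finite_toSet.image _) (by
        rintro _ ⟨k, -, rfl⟩
        exact (compl_mem_iff (hdef k)).2 fun hk => h ⟨k, hk⟩)
    obtain ⟨x, hx⟩ := nonempty_of_mem hmem
    obtain ⟨z, hz⟩ := x.exists_range_eq_singleton
    obtain ⟨k, hk, hzk⟩ := Set.mem_iUnion₂.1 (ht (Set.mem_univ z))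
    exact hx _ ⟨k, hk, rfl⟩ (by simpa [pointsOn, hz] using hzk)

end Realization

/-! ### Dimension of types -/

section Dimension

variable {K : Type u} [Field K] {G : Over (Spec (.of K))} {C : Type u} [Field C] [Algebra K C]

theorem le_zariskiDim_iff {A : Set (Points G C)} {d : WithBot ℕ∞} :
    d ≤ zariskiDim A ↔
      ∀ Z : Set G.left, IsClosed Z → A ⊆ pointsOn C Z → d ≤ topologicalKrullDim Z := by
  rw [zariskiDim, le_iInf_iff]
  exact ⟨fun h Z hZ hA => h ⟨Z, hZ, hA⟩, fun h Z => h Z.1 Z.2.1 Z.2.2⟩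

theorem zariskiDim_mono {A B : Set (Points G C)} (h : A ⊆ B) : zariskiDim A ≤ zariskiDim B :=
  le_zariskiDim_iff.2 fun Z hZ hB => le_zariskiDim_iff.1 le_rfl Z hZ (h.trans hB)

variable {L : FirstOrder.Language.{v, w}} [L.Structure C]

theorem TypeSpace.Realizes.mem_pointsOn_iff (j : FirstOrder.Language.ring →ᴸ L)
    [FirstOrder.Ring.CompatibleRing C] [j.IsExpansionOn C]
    {p : TypeSpace L G C} {x : Points G C}
    (hx : p.Realizes x) {Z : Set G.left} (hZ : IsClosed Z) :
    x ∈ pointsOn C Z ↔ pointsOn C Z ∈ p.sets := by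
  refine ⟨fun h => ?_, hx _⟩
  by_contra hp
  exact hx _ ((compl_mem_iff (isDefinableOver_pointsOn L j hZ)).2 hp) h

theorem TypeSpace.dim_le_zariskiDim_univ (p : TypeSpace L G C) :
    p.dim ≤ zariskiDim (Set.univ : Set (Points G C)) :=
  iSup₂_le fun _ _ => zariskiDim_mono (Set.subset_univ _)

/-- The dimension of a realization depends only on which closed sets belong to `p`, so all
realizations have the same one. Some realization has to exist, as otherwise the supremum defining
`p.dim` is `⊥`. -/
theorem TypeSpace.le_dim_iff (j : FirstOrder.Language.ring →ᴸ L)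
    [FirstOrder.Ring.CompatibleRing C] [j.IsExpansionOn C]
    {p : TypeSpace L G C} (hp : ∃ x, p.Realizes x) {d : WithBot ℕ∞} :
    d ≤ p.dim ↔ ∀ Z : Set G.left, IsClosed Z → pointsOn C Z ∈ p.sets →
      d ≤ topologicalKrullDim Z := by
  have key : ∀ {x}, p.Realizes x → ∀ {d}, (d ≤ zariskiDim {x} ↔
      ∀ Z : Set G.left, IsClosed Z → pointsOn C Z ∈ p.sets → d ≤ topologicalKrullDim Z) :=
    fun hx d => by
      rw [le_zariskiDim_iff]
      refine forall₂_congr fun Z hZ => ?_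
      rw [Set.singleton_subset_iff, hx.mem_pointsOn_iff j hZ]
  obtain ⟨x, hx⟩ := hp
  have hdim : p.dim = zariskiDim {x} :=
    le_antisymm (iSup₂_le fun y hy => (key hx).2 ((key hy).1 le_rfl))
      (le_iSup₂ (f := fun y (_ : p.Realizes y) => zariskiDim {y}) x hx)
  rw [hdim, key hx]

theorem TypeSpace.dim_eq_zariskiDim_univ_iff (j : FirstOrder.Language.ring →ᴸ L)
    [FirstOrder.Ring.CompatibleRing C] [j.IsExpansionOn C]
    {p : TypeSpace L G C} (hp : ∃ x, p.Realizes x) :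
    p.dim = zariskiDim (Set.univ : Set (Points G C)) ↔
      ∀ Z : Set G.left, IsClosed Z → pointsOn C Z ∈ p.sets →
        zariskiDim (Set.univ : Set (Points G C)) ≤ topologicalKrullDim Z := by
  rw [← le_dim_iff j hp]
  exact p.dim_le_zariskiDim_univ.ge_iff_eq.symm

theorem TypeSpace.exists_forall_zariskiDim_univ_le (j : FirstOrder.Language.ring →ᴸ L)
    [FirstOrder.Ring.CompatibleRing C] [j.IsExpansionOn C]
    [Nonempty (Points G C)] :
    ∃ p : TypeSpace L G C, ∀ Z : Set G.left, IsClosed Z → pointsOn C Z ∈ p.sets →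
      zariskiDim (Set.univ : Set (Points G C)) ≤ topologicalKrullDim Z := by
  classical
  have hu : IsDefinableOver L G C Set.univ := isDefinableOver_univ j
  set d := zariskiDim (Set.univ : Set (Points G C)) with hd
  -- If `d = ⊥` every type works, for instance that of an arbitrary point.
  rcases eq_bot_or_bot_lt d with h0 | h0
  · exact ⟨ofUltrafilter hu (pure (Classical.arbitrary _)), fun Z _ _ => h0 ▸ bot_le⟩
  let 𝒵 : Set (Set G.left) := {Z | IsClosed Z ∧ topologicalKrullDim Z < d}
  obtain ⟨F, hF⟩ := Ultrafilter.exists_ultrafilter_of_finite_inter_nonempty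
    ((fun Z : Set G.left => (pointsOn C Z)ᶜ) '' 𝒵) fun T hT => by
      obtain ⟨S, hS, rfl⟩ := Finset.subset_set_image_iff.1 hT
      by_contra hne
      have hcov : (Set.univ : Set (Points G C)) ⊆ pointsOn C (⋃₀ (S : Set (Set G.left))) := by
        intro x _
        by_contra hx
        refine hne ⟨x, ?_⟩
        rw [Finset.coe_image]
        rintro _ ⟨Z, hZ, rfl⟩ hxZ
        exact hx (mem_pointsOn_sUnion.2 ⟨Z, hZ, hxZ⟩)
      have hcl : IsClosed (⋃₀ (S : Set (Set G.left))) :=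
        Set.sUnion_eq_biUnion (s := (S : Set (Set G.left))) ▸
          S.finite_toSet.isClosed_biUnion fun Z hZ => (hS hZ).1
      -- A closed set containing all of `G(C)` has dimension at least `d`, but this finite union is
      -- smaller.
      exact (le_zariskiDim_iff.1 hd.le _ hcl hcov).not_gt
        (topologicalKrullDim_sUnion_lt S.finite_toSet (fun Z hZ => (hS hZ).1) h0
          fun Z hZ => (hS hZ).2)
  refine ⟨ofUltrafilter hu F, fun Z hZ hZF => ?_⟩
  by_contra hlt
  exact F.compl_notMem_iff.2 hZF.2 (hF ⟨Z, ⟨hZ, not_le.1 hlt⟩, rfl⟩)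

end Dimension

/-! ### Invariance of dimension under left translation -/

section Translation

variable {K : Type u} [Field K] {G : Over (Spec (.of K))} [GrpObj G] {C : Type u} [Field C]
  [Algebra K C]

theorem preimage_smul_pointsOn (g : Points G K) (Z : Set G.left) :
    (fun x : Points G C => g • x) ⁻¹' pointsOn C Z =
      pointsOn C ((leftTranslation g).left ⁻¹' Z) := by
  ext x
  have h : (g • x : Points G C).hom.left = x.hom.left ≫ (leftTranslation g).left := by
    rw [points_smul_def]
    rfl
  change Set.range (g • x : Points G C).hom.left ⊆ Z ↔ Set.range x.hom.left ⊆ _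
  rw [h, Set.range_subset_iff, Set.range_subset_iff]
  simp

theorem isIso_leftTranslation_left (g : Points G K) : IsIso (leftTranslation g).left := by
  have : IsIso (leftTranslation g) :=
    ⟨leftTranslation g⁻¹, by rw [← leftTranslation_mul, inv_mul_cancel, leftTranslation_one],
      by rw [← leftTranslation_mul, mul_inv_cancel, leftTranslation_one]⟩
  exact inferInstanceAs (IsIso ((Over.forget _).map (leftTranslation g)))

theorem topologicalKrullDim_preimage_leftTranslation_le (g : Points G K) (Z : Set G.left) :
    topologicalKrullDim ((leftTranslation g).left ⁻¹' Z) ≤ topologicalKrullDim Z := by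
  have := isIso_leftTranslation_left g
  have h : Topology.IsInducing (leftTranslation g).left :=
    (leftTranslation g).left.isOpenEmbedding.isInducing
  exact (h.restrictPreimage Z).topologicalKrullDim_le

end Translation

/-! ### The subflow of types of maximal dimension -/

theorem mainTheorem8 (L : FirstOrder.Language.{v, w}) (j : FirstOrder.Language.ring →ᴸ L)
    (K : Type u) [Field K] [L.Structure K] [FirstOrder.Ring.CompatibleRing K] [j.IsExpansionOn K]
    (C : Type u) [Field C] [L.Structure C] [FirstOrder.Ring.CompatibleRing C] [j.IsExpansionOn C]
    [Algebra K C] (hC : IsMonsterModel L K C)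
    (hNIP : HasNIP L K) (hdef : AllTypesDefinable L K C)
    (G : Over (Spec (.of K))) [GrpObj G] [LocallyOfFiniteType G.hom] [QuasiCompact G.hom] :
    IsSubflow (Points G K)
      {p : TypeSpace L G C | p.dim = zariskiDim (Set.univ : Set (Points G C))} ∧
    ∃ p : TypeSpace L G C, IsAlmostPeriodic (Points G K) p ∧
      p.dim = zariskiDim (Set.univ : Set (Points G C)) := by
  obtain ⟨κ, -, hK, -, hκ, -⟩ := hC.exists_cardinal
  have hiff := fun p : TypeSpace L G C =>
    TypeSpace.dim_eq_zariskiDim_univ_iff j (p.exists_realizes j hκ hK)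
  have hJ : IsSubflow (Points G K)
      {p : TypeSpace L G C | p.dim = zariskiDim (Set.univ : Set (Points G C))} := by
    refine ⟨?_, ?_, fun g p hp => ?_⟩
    · have : Nonempty (Points G C) := ⟨1⟩
      obtain ⟨p, hp⟩ := TypeSpace.exists_forall_zariskiDim_univ_le (G := G) (C := C) j
      exact ⟨p, (hiff p).2 hp⟩
    · have e : {p : TypeSpace L G C | p.dim = zariskiDim (Set.univ : Set (Points G C))} =
          ⋂ (Z : Set G.left) (_ : IsClosed Z)
            (_ : topologicalKrullDim Z < zariskiDim (Set.univ : Set (Points G C))),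
            {p : TypeSpace L G C | pointsOn C Z ∉ p.sets} := by
        ext p
        simp only [Set.mem_iInter]
        refine (hiff p).trans (forall₂_congr fun Z _ => ?_)
        rw [← not_lt]
        exact imp_not_comm
      rw [e]
      exact isClosed_iInter fun Z => isClosed_iInter fun hZ => isClosed_iInter fun _ =>
        TypeSpace.isClosed_setOf_notMem (isDefinableOver_pointsOn L j hZ)
    · refine (hiff _).2 fun Z hZ hZp => ?_
      -- By definition, `g • p` contains `Z(C)` when `p` contains its preimage, which consists of
      -- the points on the translate of `Z` by the inverse of `g`.
      have h : (fun x : Points G C => g • x) ⁻¹' pointsOn C Z ∈ p.sets := hZp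
      rw [preimage_smul_pointsOn] at h
      exact ((hiff p).1 hp _ (hZ.preimage (leftTranslation g).left.continuous) h).trans
        (topologicalKrullDim_preimage_leftTranslation_le g Z)
  have : CompactSpace (TypeSpace L G C) := TypeSpace.compactSpace (isDefinableOver_univ j)
  obtain ⟨p, hp, hap⟩ := hJ.exists_isAlmostPeriodic_mem
  exact ⟨hJ, p, hap, hp⟩
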